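/- Let $X$ be a nonsingular projective threefold over $\mathbb{C}$ with an ample line bundle $\mathcal{O}_X(1)$, let $n\in\mathbb{Z}$, and let $p$ be a polynomial. Let $\mathcal{A}_p$ be the category of coherent sheaves on $X$ that are zero or Gieseker semistable with reduced Hilbert polynomial $p$, and let $\mathcal{B}_p$ be the category of triples $E=(F,V,\phi)$ with $F\in\mathcal{A}_p$, $V$ a finite-dimensional complex vector space and $\phi:V\to\operatorname{Hom}(\mathcal{O}_X(-n),F)$ linear; a morphism is a pair consisting of a sheaf map and a linear map compatible with the $\phi$'s. The class of $(F,V,\phi)$ is $([F],\dim V)$ with $[F]$ in the numerical Grothendieck group $K^{num}(\operatorname{coh}X)$. Put $\tilde\tau(\beta,0)=0$ and $\tilde\tau(\beta,r)=1$ for $r>0$. A nonzero object $E$ is $\tilde\tau$-semistable (resp. $\tilde\tau$-stable) if $\tilde\tau([S])\le\tilde\tau([E/S])$ (resp. $<$) for all nonzero proper subobjects $S\subset E$ in $\mathcal{B}_p$. Fix a class $\beta$. Let $D(\beta)$ be the set of ordered pairs $(\beta_k,\beta_l)$ with $\beta_k+\beta_l=\beta$ such that every sheaf in $\mathcal{A}_p$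 of class $\beta_k$ or $\beta_l$ is zero or Gieseker stable. By an extension of type $(\beta_k,\beta_l)$ we mean a short exact sequence $0\to E_1\to E_2\to E_3\to0$ in $\mathcal{B}_p$ with $E_1,E_3$ $\tilde\tau$-stable of classes $(\beta_k,1)$ and $(\beta_l,1)$. Fix $d\ge 0$ and let $\mathfrak{S}^{(\beta,2)}_{ss}$ be the set of $\mathbb{C}$-points of the parameter scheme of $\tilde\tau$-semistable rigidified objects of type $(\beta,2)$: such a point is a quotient $\mathbb{C}^d\otimes\mathcal{O}_X(-n)\twoheadrightarrow F$ with $F\in\mathcal{A}_p$, $[F]=\beta$ and $\mathbb{C}^d\cong H^0(F(n))$, together with a linear map $\rho:\mathbb{C}^2\to H^0(F(n))$ such that $E_2=(F,\mathbb{C}^2,\rho)$ is $\tilde\tau$-semistable. Let $\mathfrak{S}_{st\text{-}ss}$, $\mathfrak{S}_{n\text{-}sp}$ and $\mathfrak{S}_{sp}$ be the sets of points whose object $E_2$ admits, respectively, an extension, a non-split extension, and a split extension of some type in $D(\beta)$. Let $\mathfrak{S}^{(\beta_k,\beta_l)}_{n\text{-}sp}$ be the set of points whose object admits a non-split extension of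 type $(\beta_k,\beta_l)$, and let $\mathfrak{S}^{(\beta_k,\beta_l)}_{1}$ (resp. $\mathfrak{S}^{(\beta_k,\beta_l)}_{2}$) be the set of points whose object admits such a non-split extension with $E_1\not\cong E_3$ (resp. $E_1\cong E_3$). Then: 1. If, for all classes $\beta_k,\beta_l$ of nonzero objects of $\mathcal{A}_p$ with $\beta_k+\beta_l=\beta$, all objects of $\mathcal{A}_p$ of class $\beta_k$ or $\beta_l$ are Gieseker stable, then every ordered pair $(\beta_k,\beta_l)$ of such classes belongs to $D(\beta)$. 2. $\mathfrak{S}_{st\text{-}ss}=\mathfrak{S}_{n\text{-}sp}\sqcup\mathfrak{S}_{sp}$ (disjoint union). 3. $\displaystyle \mathfrak{S}_{n\text{-}sp}=\bigsqcup_{(\beta_k,\beta_l)\in D(\beta)}\mathfrak{S}^{(\beta_k,\beta_l)}_{n\text{-}sp}$ (disjoint union over ordered pairs). 4. For each $(\beta_k,\beta_l)\in D(\beta)$, $\mathfrak{S}^{(\beta_k,\beta_l)}_{n\text{-}sp}=\mathfrak{S}^{(\beta_k,\beta_l)}_{1}\sqcup\mathfrak{S}^{(\beta_k,\beta_l)}_{2}$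 (disjoint union), and $\mathfrak{S}^{(\beta_k,\beta_l)}_{2}=\varnothing$ if $\beta_k\ne\beta_l$. 5. If an object $E_2$ of $\mathcal{B}_p$ has a non-split extension $0\to E_1\to E_2\to E_3\to0$ of a type in $D(\beta)$, then every other extension $0\to E_1'\to E_2\to E_3'\to0$ of a type in $D(\beta)$ is non-split and has the same type, $E_3'\cong E_3$, and the underlying sheaves of $E_1$ and $E_1'$ are isomorphic. If moreover the underlying sheaf of $E_3$ is nonzero, then there are isomorphisms $E_1\cong E_1'$ and $E_3\cong E_3'$ compatible with the maps from $E_1,E_1'$ to $E_2$ and from $E_2$ to $E_3,E_3'$; that is, the two extensions have the same subobject of $E_2$. -/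

import Mathlib

open CategoryTheory Limits AlgebraicGeometry Opposite Polynomial

noncomputable section

namespace SheafTriples

/-! ### The `ℂ`-linear structure on the category of `𝒪_X`-modules of a `ℂ`-scheme -/

/-- The ring map `ℂ → Γ(X, U)` given by the structure morphism of a `ℂ`-scheme. -/
def scalar {X : Scheme.{0}} (f : X ⟶ Spec (.of ℂ)) (U : X.Opens) : ℂ →+* Γ(X, U) :=
  (X.presheaf.map (homOfLE le_top : U ⟶ ⊤).op).hom.comp
    ((f.appTop).hom.comp (Scheme.ΓSpecIso (.of ℂ)).inv.hom)

theorem scalar_map {X : Scheme.{0}} (f : X ⟶ Spec (.of ℂ)) {U V : X.Opens} (i : U ⟶ V) (c : ℂ) :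
    X.presheaf.map i.op (scalar f V c) = scalar f U c := by
  simp only [scalar, RingHom.comp_apply]
  rw [← CommRingCat.comp_apply, ← Functor.map_comp]
  rfl

/-- Multiplication by a complex number, as an endomorphism of an `𝒪_X`-module. -/
def scalarEnd {X : Scheme.{0}} (f : X ⟶ Spec (.of ℂ)) (M : X.Modules) (c : ℂ) : M ⟶ M :=
  ⟨PresheafOfModules.homMk
    { app := fun U => M.smul (scalar f U.unop c)
      naturality := fun U V i => by
        rw [← scalar_map f i.unop c]
        exact (Scheme.Modules.map_comp_smul i.unop (scalar f U.unop c)).symm }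
    (fun U r m => by
      exact smul_comm (M := Γ(X, U.unop)) (N := Γ(X, U.unop)) (α := Γ(M, U.unop))
        (scalar f U.unop c) r m)⟩

def scalarCenter {X : Scheme.{0}} (f : X ⟶ Spec (.of ℂ)) : ℂ →+* CatCenter X.Modules where
  toFun c :=
    { app := fun M => scalarEnd f M c
      naturality := fun M N g => by
        apply Scheme.Modules.hom_ext
        intro U
        ext x
        exact (Scheme.Modules.Hom.app_smul g (scalar f U c) x).symm }
  map_one' := by
    ext M U x
    change scalar f U 1 • x = x
    rw [map_one, one_smul]
  map_mul' a b := by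
    ext M U x
    change scalar f U (a * b) • x = scalar f U a • (scalar f U b • x)
    rw [map_mul, mul_smul]
  map_zero' := by
    ext M U x
    change scalar f U 0 • x = 0
    rw [map_zero, zero_smul]
  map_add' a b := by
    ext M U x
    change scalar f U (a + b) • x = scalar f U a • x + scalar f U b • x
    rw [map_add, add_smul]

/-! ### Tensor products, ample sheaves, coherent sheaves -/

/-- The structure sheaf as a module over itself. -/
def unitSheaf (X : Scheme.{0}) : X.Modules := SheafOfModules.unit X.ringCatSheaf

/-- The tensor product of two `𝒪_X`-modules: the sheafification of `U ↦ M(U) ⊗ N(U)`. -/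
def tensor {X : Scheme.{0}} (M N : X.Modules) : X.Modules :=
  (PresheafOfModules.sheafification (𝟙 X.ringCatSheaf.obj)).obj
    (PresheafOfModules.Monoidal.tensorObj (R := X.presheaf) M.val N.val)

/-- The tensor power `M^{⊗ m}`. -/
def tensorPow {X : Scheme.{0}} (M : X.Modules) : ℕ → X.Modules
  | 0 => unitSheaf X
  | m + 1 => tensor (tensorPow M m) M

/-- Restriction of sections. -/
def res {X : Scheme.{0}} (M : X.Modules) {U V : X.Opens} (h : V ≤ U) (s : Γ(M, U)) : Γ(M, V) :=
  M.presheaf.map (homOfLE h).op s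

/-- Restriction of functions. -/
def resFun {X : Scheme.{0}} {U V : X.Opens} (h : V ≤ U) (a : Γ(X, U)) : Γ(X, V) :=
  X.presheaf.map (homOfLE h).op a

/-- The locus where a global section `s` of `M` freely generates `M`; if `M` is invertible, this is
the open set `X_s` of points at which `s` does not vanish. -/
def generatingLocus {X : Scheme.{0}} (M : X.Modules) (s : Γ(M, ⊤)) : X.Opens :=
  sSup {U | ∀ V : X.Opens, V ≤ U →
    Function.Bijective (fun a : Γ(X, V) => a • res M (le_top : V ≤ ⊤) s)}

/-- An invertible sheaf `L` is ample: the scheme is quasi-compact and its points have affine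
neighbourhoods of the form `X_s` for sections `s` of positive powers of `L`. -/
def IsAmple {X : Scheme.{0}} (L : X.Modules) : Prop :=
  CompactSpace X ∧ ∀ x : X, ∃ (m : ℕ) (s : Γ(tensorPow L m, ⊤)), 1 ≤ m ∧
    x ∈ generatingLocus (tensorPow L m) s ∧ IsAffineOpen (generatingLocus (tensorPow L m) s)

/-- `M` is of finite type: locally generated by finitely many sections. -/
def IsOfFiniteType {X : Scheme.{0}} (M : X.Modules) : Prop :=
  ∀ x : X, ∃ (U : X.Opens) (n : ℕ) (s : Fin n → Γ(M, U)), x ∈ U ∧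
    ∀ (V : X.Opens) (hV : V ≤ U) (t : Γ(M, V)), ∀ y ∈ V,
      ∃ (W : X.Opens) (hW : W ≤ V) (a : Fin n → Γ(X, W)), y ∈ W ∧
        res M hW t = ∑ i, a i • res M (hW.trans hV) (s i)

/-- The sheaf of relations between finitely many sections of `M` over an open set is always of
finite type. -/
def HasFiniteRelations {X : Scheme.{0}} (M : X.Modules) : Prop :=
  ∀ (U : X.Opens) (n : ℕ) (s : Fin n → Γ(M, U)), ∀ x ∈ U,
    ∃ (V : X.Opens) (hV : V ≤ U) (m : ℕ) (r : Fin m → Fin n → Γ(X, V)), x ∈ V ∧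
      (∀ j, ∑ i, r j i • res M hV (s i) = 0) ∧
      ∀ (W : X.Opens) (hW : W ≤ V) (a : Fin n → Γ(X, W)),
        ∑ i, a i • res M (hW.trans hV) (s i) = 0 → ∀ y ∈ W,
        ∃ (W' : X.Opens) (hW' : W' ≤ W) (c : Fin m → Γ(X, W')), y ∈ W' ∧
          ∀ i, resFun hW' (a i) = ∑ j, c j * resFun (hW'.trans hW) (r j i)

/-- Coherent `𝒪_X`-modules. -/
def IsCoherent {X : Scheme.{0}} (M : X.Modules) : Prop :=
  IsOfFiniteType M ∧ HasFiniteRelations M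

/-! ### Polarized threefolds, Hilbert polynomials and Gieseker stability -/

/-- A nonsingular projective threefold over `ℂ` (a proper smooth integral scheme of relative
dimension `3` that carries an ample invertible sheaf) together with a polarization `L`. -/
structure PolarizedThreefold where
  X : Scheme.{0}
  str : X ⟶ Spec (.of ℂ)
  isIntegral : IsIntegral X
  isProper : IsProper str
  isSmooth : SmoothOfRelativeDimension 3 str
  /-- the polarization -/
  L : X.Modules
  /-- the dual of the polarization -/
  Linv : X.Modules
  invertible : Nonempty (tensor L Linv ≅ unitSheaf X)
  ample : IsAmple L

variable (T : PolarizedThreefold)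

instance : Linear ℂ T.X.Modules := Linear.ofRingMorphism (scalarCenter T.str)

/-- The line bundle `𝒪_X(m) = L^{⊗ m}`. -/
def PolarizedThreefold.O : ℤ → T.X.Modules
  | Int.ofNat m => tensorPow T.L m
  | Int.negSucc m => tensorPow T.Linv (m + 1)

/-- `dim_ℂ Ext^i(E, F)`. -/
def extDim (E F : T.X.Modules) (i : ℕ) : ℕ :=
  letI := HasExt.standard T.X.Modules
  Module.finrank ℂ (Abelian.Ext.{1} E F i)

/-- The Euler form `∑ i, (-1)^i dim Ext^i(E, F)`. -/
def euler (E F : T.X.Modules) : ℤ := ∑ᶠ i : ℕ, (-1) ^ i * (extDim T E F i : ℤ)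

open Classical in
/-- The Hilbert polynomial: the polynomial `P` with `P(m) = χ(F(m))` for all integers `m`, where
`χ(F(m)) = ∑ i, (-1)^i dim H^i(X, F(m))` and `H^i(X, -) = Ext^i(𝒪_X, -)`. -/
def hilbertPoly (F : T.X.Modules) : ℚ[X] :=
  if h : ∃ P : ℚ[X], ∀ m : ℤ,
      P.eval (m : ℚ) = (euler T (unitSheaf T.X) (tensor F (T.O m)) : ℚ)
  then h.choose else 0

/-- The reduced Hilbert polynomial: the Hilbert polynomial divided by its leading coefficient. -/
def redHilb (F : T.X.Modules) : ℚ[X] :=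
  C (hilbertPoly T F).leadingCoeff⁻¹ * hilbertPoly T F

/-- The order on reduced Hilbert polynomials: polynomials of larger degree are smaller, and
polynomials of the same degree are compared by their values at large integers. -/
def PolyLT (P Q : ℚ[X]) : Prop :=
  Q.natDegree < P.natDegree ∨
    (P.natDegree = Q.natDegree ∧ ∀ᶠ t : ℕ in Filter.atTop, P.eval (t : ℚ) < Q.eval (t : ℚ))

/-- The non-strict version of `PolyLT`. -/
def PolyLE (P Q : ℚ[X]) : Prop :=
  Q.natDegree < P.natDegree ∨
    (P.natDegree = Q.natDegree ∧ ∀ᶠ t : ℕ in Filter.atTop, P.eval (t : ℚ) ≤ Q.eval (t : ℚ))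

/-- Gieseker semistability of a nonzero coherent sheaf. By additivity of Hilbert polynomials the
condition on subsheaves and the one on quotients are equivalent to each other; both are recorded.
With the order `PolyLE`, semistable sheaves are automatically pure. -/
def GiesekerSemistable (F : T.X.Modules) : Prop :=
  IsCoherent F ∧ ¬ IsZero F ∧
    (∀ (S : T.X.Modules) (i : S ⟶ F), IsCoherent S → ¬ IsZero S → Mono i →
      PolyLE (redHilb T S) (redHilb T F)) ∧
    (∀ (Q : T.X.Modules) (q : F ⟶ Q), IsCoherent Q → ¬ IsZero Q → Epi q →
      PolyLE (redHilb T F) (redHilb T Q))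

/-- Gieseker stability of a nonzero coherent sheaf: strict inequalities for the proper nonzero
subsheaves and quotients. -/
def GiesekerStable (F : T.X.Modules) : Prop :=
  IsCoherent F ∧ ¬ IsZero F ∧
    (∀ (S : T.X.Modules) (i : S ⟶ F), IsCoherent S → ¬ IsZero S → Mono i → ¬ IsIso i →
      PolyLT (redHilb T S) (redHilb T F)) ∧
    (∀ (Q : T.X.Modules) (q : F ⟶ Q), IsCoherent Q → ¬ IsZero Q → Epi q → ¬ IsIso q →
      PolyLT (redHilb T F) (redHilb T Q))

/-- The objects of `𝒜_p`: zero sheaves and semistable sheaves with reduced Hilbert polynomial `p`. -/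
def InAp (p : ℚ[X]) (F : T.X.Modules) : Prop :=
  IsCoherent F ∧ (IsZero F ∨ (GiesekerSemistable T F ∧ redHilb T F = p))

/-! ### The numerical Grothendieck group of coherent sheaves -/

/-- Coherent sheaves on `X`. -/
def CohSheaf : Type 1 := {F : T.X.Modules // IsCoherent F}

/-- The Euler form on the free abelian group on coherent sheaves. -/
def eulerForm : FreeAbelianGroup (CohSheaf T) →+ FreeAbelianGroup (CohSheaf T) →+ ℤ :=
  FreeAbelianGroup.lift fun E => FreeAbelianGroup.lift fun F => euler T E.1 F.1

/-- The relations `[F] = [S] + [Q]` for short exact sequences `0 → S → F → Q → 0`. -/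
def exactRelations : AddSubgroup (FreeAbelianGroup (CohSheaf T)) :=
  AddSubgroup.closure {x | ∃ (S F Q : CohSheaf T) (i : S.1 ⟶ F.1) (q : F.1 ⟶ Q.1) (w : i ≫ q = 0),
    (ShortComplex.mk i q w).ShortExact ∧
      x = FreeAbelianGroup.of F - FreeAbelianGroup.of S - FreeAbelianGroup.of Q}

/-- The two-sided kernel of the Euler form. -/
def eulerKernel : AddSubgroup (FreeAbelianGroup (CohSheaf T)) where
  carrier := {a | ∀ b, eulerForm T a b = 0 ∧ eulerForm T b a = 0}
  zero_mem' := by simp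
  add_mem' := by
    intro a b ha hb c
    simp [ha c, hb c]
  neg_mem' := by
    intro a ha c
    simp [ha c]

/-- The numerical Grothendieck group `K^num(coh X)`: the Grothendieck group modulo the two-sided
kernel of the Euler form. -/
abbrev Knum : Type 1 := FreeAbelianGroup (CohSheaf T) ⧸ (exactRelations T ⊔ eulerKernel T)

/-- The numerical class of a coherent sheaf. -/
def sheafClass (F : T.X.Modules) (hF : IsCoherent F) : Knum T :=
  QuotientAddGroup.mk (FreeAbelianGroup.of (⟨F, hF⟩ : CohSheaf T))

/-- The positive cone `C(𝒜_p)`: the classes of nonzero objects of `𝒜_p`. -/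
def positiveCone (p : ℚ[X]) : Set (Knum T) :=
  {γ | ∃ (F : T.X.Modules) (hF : InAp T p F), ¬ IsZero F ∧ sheafClass T F hF.1 = γ}

/-! ### The category `ℬ_p` and its weak stability condition -/

/-- Objects `(F, V, φ)` of `ℬ_p`: an object `F` of `𝒜_p`, a finite dimensional complex vector space
`V`, and a linear map `φ : V → Hom(𝒪_X(-n), F)`. -/
structure Bp (n : ℤ) (p : ℚ[X]) where
  F : T.X.Modules
  inAp : InAp T p F
  V : Type
  [addCommGroup : AddCommGroup V]
  [module : Module ℂ V]
  [finiteDimensional : FiniteDimensional ℂ V]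
  φ : V →ₗ[ℂ] (T.O (-n) ⟶ F)

attribute [instance] Bp.addCommGroup Bp.module Bp.finiteDimensional

variable {T} {n : ℤ} {p : ℚ[X]}

namespace Bp

/-- Morphisms of `ℬ_p`: pairs `(f, g)` with `φ' ∘ g = f ∘ φ`. -/
@[ext]
structure Hom (E E' : Bp T n p) where
  f : E.F ⟶ E'.F
  g : E.V →ₗ[ℂ] E'.V
  comm : ∀ v, E'.φ (g v) = E.φ v ≫ f

instance : Category (Bp T n p) where
  Hom := Hom
  id E := ⟨𝟙 _, LinearMap.id, by simp⟩
  comp a b := ⟨a.f ≫ b.f, b.g.comp a.g, by simp [a.comm, b.comm]⟩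
  id_comp a := by ext <;> simp
  comp_id a := by ext <;> simp
  assoc a b c := by ext <;> simp

/-- The class of `(F, V, φ)` in `K(ℬ_p)`, that is `([F], dim V)`. -/
def cls (E : Bp T n p) : Knum T × ℤ :=
  (sheafClass T E.F E.inAp.1, (Module.finrank ℂ E.V : ℤ))

/-- The zero objects of `ℬ_p`. -/
def IsZeroObj (E : Bp T n p) : Prop := IsZero E.F ∧ Subsingleton E.V

/-- Short exact sequences `0 → S → E → Q → 0` in `ℬ_p`. -/
def IsShortExact {S E Q : Bp T n p} (i : S ⟶ E) (q : E ⟶ Q) : Prop :=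
  (∃ w : i.f ≫ q.f = 0, (ShortComplex.mk i.f q.f w).ShortExact) ∧
    Function.Injective i.g ∧ Function.Exact i.g q.g ∧ Function.Surjective q.g

end Bp

/-- The weak stability condition: `0` on classes `(β, 0)` and `1` on classes `(β, d)` with
`d > 0`. -/
def tauTilde (c : Knum T × ℤ) : ℕ := if c.2 = 0 then 0 else 1

namespace Bp

/-- `τ̃`-semistable objects of `ℬ_p`. -/
def Semistable (E : Bp T n p) : Prop :=
  ¬ E.IsZeroObj ∧ ∀ (S Q : Bp T n p) (i : S ⟶ E) (q : E ⟶ Q), IsShortExact i q →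
    ¬ S.IsZeroObj → ¬ Q.IsZeroObj → tauTilde S.cls ≤ tauTilde Q.cls

/-- `τ̃`-stable objects of `ℬ_p`. -/
def Stable (E : Bp T n p) : Prop :=
  ¬ E.IsZeroObj ∧ ∀ (S Q : Bp T n p) (i : S ⟶ E) (q : E ⟶ Q), IsShortExact i q →
    ¬ S.IsZeroObj → ¬ Q.IsZeroObj → tauTilde S.cls < tauTilde Q.cls

/-- A short exact sequence `0 → E₁ → E₂ → E₃ → 0` in `ℬ_p` that exhibits `E₂` as an extension of
`τ̃`-stable objects of rank one. -/
structure StableExtension (E₂ : Bp T n p) where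
  E₁ : Bp T n p
  E₃ : Bp T n p
  ι : E₁ ⟶ E₂
  π : E₂ ⟶ E₃
  exact : IsShortExact ι π
  stable₁ : E₁.Stable
  stable₃ : E₃.Stable
  rank₁ : E₁.cls.2 = 1
  rank₃ : E₃.cls.2 = 1

namespace StableExtension

variable {E₂ : Bp T n p}

/-- The ordered pair `(β_k, β_l)` such that `E₁` and `E₃` have classes `(β_k, 1)` and
`(β_l, 1)`. -/
def type (e : StableExtension E₂) : Knum T × Knum T := (e.E₁.cls.1, e.E₃.cls.1)

/-- The extension is split. -/
def IsSplit (e : StableExtension E₂) : Prop := IsSplitMono e.ι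

/-- The sub-object and the quotient are isomorphic in `ℬ_p`. -/
def EndsIsomorphic (e : StableExtension E₂) : Prop := Nonempty (e.E₁ ≅ e.E₃)

end StableExtension

end Bp

/-! ### Decompositions of a class -/

variable (T) in
/-- Every object of `𝒜_p` of class `γ` is zero or a Gieseker stable sheaf. -/
def StableClass (p : ℚ[X]) (γ : Knum T) : Prop :=
  ∀ (F : T.X.Modules) (hF : InAp T p F), sheafClass T F hF.1 = γ → IsZero F ∨ GiesekerStable T F

variable (T) in
/-- The standing condition on `β`: it is indecomposable, or whenever it is decomposed as a sum of
two classes of nonzero objects of `𝒜_p`, the objects with these classes are Gieseker stable. -/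
def StandingCondition (p : ℚ[X]) (β : Knum T) : Prop :=
  ∀ βk ∈ positiveCone T p, ∀ βl ∈ positiveCone T p, βk + βl = β →
    ∀ (F : T.X.Modules) (hF : InAp T p F),
      sheafClass T F hF.1 = βk ∨ sheafClass T F hF.1 = βl → GiesekerStable T F

variable (T) in
/-- The ordered decompositions `β = β_k + β_l` that satisfy the stability condition on the sheaves
with classes `β_k` and `β_l`. A class is allowed to be zero, so that `(β, 0)` and `(0, β)` occur
when all sheaves of class `β` are stable. -/
def decompositions (p : ℚ[X]) (β : Knum T) : Set (Knum T × Knum T) :=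
  {γ | γ.1 + γ.2 = β ∧ StableClass T p γ.1 ∧ StableClass T p γ.2}

/-! ### The points of the parameter scheme and its strata -/

variable (T) in
/-- Data representing a `ℂ`-point of the scheme that parametrizes `τ̃`-semistable rigidified objects
of type `(β, r)`: a sheaf `F` of `𝒜_p` of class `β`, written as a quotient of `ℂ^d ⊗ 𝒪_X(-n)` such
that `ℂ^d → Hom(𝒪_X(-n), F) = H⁰(F(n))` is an isomorphism, and a linear map
`ρ : ℂ^r → Hom(𝒪_X(-n), F)` such that the object `(F, ℂ^r, ρ)` is `τ̃`-semistable. -/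
structure PointData (n : ℤ) (p : ℚ[X]) (d r : ℕ) (β : Knum T) where
  F : T.X.Modules
  inAp : InAp T p F
  class_eq : sheafClass T F inAp.1 = β
  q : (Fin d → ℂ) →ₗ[ℂ] (T.O (-n) ⟶ F)
  bijective : Function.Bijective q
  epi : Epi (Sigma.desc fun i : Fin d => q (Pi.single i 1))
  ρ : (Fin r → ℂ) →ₗ[ℂ] (T.O (-n) ⟶ F)
  semistable : Bp.Semistable (⟨F, inAp, Fin r → ℂ, ρ⟩ : Bp T n p)

/-- The object `(F, ℂ^r, ρ)` of `ℬ_p`. -/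
def PointData.obj {d r : ℕ} {β : Knum T} (x : PointData T n p d r β) : Bp T n p :=
  ⟨x.F, x.inAp, Fin r → ℂ, x.ρ⟩

/-- Two data represent the same point if they define the same quotient of `ℂ^d ⊗ 𝒪_X(-n)` with the
same sections. -/
instance pointSetoid (T : PolarizedThreefold) (n : ℤ) (p : ℚ[X]) (d r : ℕ) (β : Knum T) :
    Setoid (PointData T n p d r β) where
  r x y := ∃ f : x.F ≅ y.F, (∀ v, x.q v ≫ f.hom = y.q v) ∧ (∀ v, x.ρ v ≫ f.hom = y.ρ v)
  iseqv :=
    { refl := fun x => ⟨Iso.refl _, by simp, by simp⟩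
      symm := fun {x y} ⟨f, h, h'⟩ => ⟨f.symm, by simp [← h], by simp [← h']⟩
      trans := fun {x y z} ⟨f, h, h'⟩ ⟨g, k, k'⟩ =>
        ⟨f ≪≫ g, by simp [← k, ← h], by simp [← k', ← h']⟩ }

/-- The set of `ℂ`-points of the parameter scheme of `τ̃`-semistable rigidified objects of type
`(β, r)`. -/
def ParamPoints (T : PolarizedThreefold) (n : ℤ) (p : ℚ[X]) (d r : ℕ) (β : Knum T) : Type 1 :=
  Quotient (pointSetoid T n p d r β)

section Strata

variable (T n p) (d : ℕ) (β : Knum T)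

/-- The points whose object is an extension of rank one `τ̃`-stable objects, with a given property,
and of a type in the given set of pairs of classes. -/
def extensionLocus (D : Set (Knum T × Knum T))
    (P : ∀ {E₂ : Bp T n p}, Bp.StableExtension E₂ → Prop) : Set (ParamPoints T n p d 2 β) :=
  {x | ∃ (y : PointData T n p d 2 β) (e : Bp.StableExtension y.obj),
    Quotient.mk _ y = x ∧ e.type ∈ D ∧ P e}

/-- Extensions of two rank one `τ̃`-stable objects. -/
def stssLocus : Set (ParamPoints T n p d 2 β) :=
  extensionLocus T n p d β (decompositions T p β) fun _ => True

/-- Split extensions. -/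
def splitLocus : Set (ParamPoints T n p d 2 β) :=
  extensionLocus T n p d β (decompositions T p β) fun e => e.IsSplit

/-- Non-split extensions. -/
def nonsplitLocus : Set (ParamPoints T n p d 2 β) :=
  extensionLocus T n p d β (decompositions T p β) fun e => ¬ e.IsSplit

/-- Non-split extensions of type `γ = (β_k, β_l)`. -/
def nonsplitStratum (γ : Knum T × Knum T) : Set (ParamPoints T n p d 2 β) :=
  extensionLocus T n p d β {γ} fun e => ¬ e.IsSplit

/-- Non-split extensions of type `γ = (β_k, β_l)` with `E₁` and `E₃` not isomorphic. -/
def stratumOne (γ : Knum T × Knum T) : Set (ParamPoints T n p d 2 β) :=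
  extensionLocus T n p d β {γ} fun e => ¬ e.IsSplit ∧ ¬ e.EndsIsomorphic

/-- Non-split extensions of type `γ = (β_k, β_l)` with `E₁` and `E₃` isomorphic. -/
def stratumTwo (γ : Knum T × Knum T) : Set (ParamPoints T n p d 2 β) :=
  extensionLocus T n p d β {γ} fun e => ¬ e.IsSplit ∧ e.EndsIsomorphic

end Strata

end SheafTriples

end

/-! Everything rests on the last assertion, the uniqueness of non-split extensions. Let `e` and `e'`
be extensions of `E₂` with `e` non-split, and consider the composite `E₁ → E₂ → E₃'`. The ends are
stable of rank one with sheaves zero or Gieseker stable, so Schur's lemma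
(`Stable.isIso_or_eq_zero`) leaves three cases. If the composite is invertible, `e` splits. If it
vanishes, `E₁` factors through `E₁'`, and Schur's lemma again identifies the two sub-objects.

The remaining case has `E₁.F ≠ 0` and `E₃'.F = 0`. There both sub-objects carry the whole sheaf of
`E₂` and differ only by a line in `V`, so they need not coincide. Types and quotients still agree,
and being split depends only on the rank of `φ` on `E₂` (`not_isSplit_of_isIso`).

Disjointness of the strata follows: two data for one point have isomorphic objects, so an extension
of one can be transported to the other and compared.

Schur's lemma for sheaves requires the image of a map of coherent sheaves to be coherent, because
stability is tested only on coherent sheaves. -/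

noncomputable section

namespace SheafTriples

/-! ### Epimorphisms of sheaves of modules lift sections locally. -/

section LocalSurjectivity
variable {C : Type} [Category.{0} C] {J : GrothendieckTopology C} {R : Sheaf J RingCat.{0}}
  [HasSheafify J AddCommGrpCat.{0}] [J.WEqualsLocallyBijective AddCommGrpCat.{0}]

/-- The composite goes between presheaves underlying sheaves, so by fullness it comes from a map of
sheaves. That map is killed by the epimorphism `q`, hence is zero. -/
theorem presheafCokernel_unit_eq_zero {M N : SheafOfModules.{0} R} (q : M ⟶ N) [Epi q] :
    cokernel.π ((SheafOfModules.forget R ⋙ PresheafOfModules.restrictScalars (𝟙 R.obj)).map q) ≫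
      (PresheafOfModules.sheafificationAdjunction (𝟙 R.obj)).unit.app _ = 0 := by
  set G := SheafOfModules.forget R ⋙ PresheafOfModules.restrictScalars (𝟙 R.obj) with hG
  set adj := PresheafOfModules.sheafificationAdjunction (𝟙 R.obj)
  have : G.IsRightAdjoint := adj.isRightAdjoint
  have : G.Full := inferInstanceAs
    (SheafOfModules.forget R ⋙ PresheafOfModules.restrictScalars (𝟙 R.obj)).Full
  have : G.Faithful := inferInstanceAs
    (SheafOfModules.forget R ⋙ PresheafOfModules.restrictScalars (𝟙 R.obj)).Faithful
  have : G.PreservesZeroMorphisms := Functor.preservesZeroMorphisms_of_isRightAdjoint G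
  have h : q ≫ G.preimage (cokernel.π (G.map q) ≫ adj.unit.app _) = 0 := by
    apply G.map_injective
    rw [Functor.map_comp, Functor.map_preimage, cokernel.condition_assoc, Limits.zero_comp,
      Functor.map_zero]
  have h0 := zero_of_epi_comp _ h
  rw [← G.map_preimage (cokernel.π (G.map q) ≫ adj.unit.app _), h0, Functor.map_zero]

end LocalSurjectivity

variable {X : Scheme.{0}}

theorem exists_local_lift_of_epi {M N : X.Modules} (q : M ⟶ N) [Epi q] {V : X.Opens}
    (t : Γ(N, V)) {y : X} (hy : y ∈ V) :
    ∃ (W : X.Opens) (hW : W ≤ V) (s : Γ(M, W)), y ∈ W ∧ q.app W s = res N hW t := by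
  let q' : (show SheafOfModules X.ringCatSheaf from M) ⟶ (show SheafOfModules X.ringCatSheaf from N)
    := q
  have : Epi q' := ‹Epi q›
  have h := presheafCokernel_unit_eq_zero q'
  set G := SheafOfModules.forget X.ringCatSheaf ⋙
    PresheafOfModules.restrictScalars (𝟙 X.ringCatSheaf.obj)
  set P := cokernel (G.map q')
  set c : G.obj N ⟶ P := cokernel.π (G.map q')
  have h1 : (PresheafOfModules.toPresheaf _).map c ≫
      CategoryTheory.toSheafify (Opens.grothendieckTopology X) P.presheaf = 0 := by
    rw [← PresheafOfModules.toPresheaf_map_sheafificationAdjunction_unit_app (𝟙 X.ringCatSheaf.obj)]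
    refine (Functor.map_comp _ _ _).symm.trans ?_
    exact (congrArg _ h).trans (Functor.map_zero _ _ _)
  have h1' : (CategoryTheory.toSheafify (Opens.grothendieckTopology X) P.presheaf).app (op V)
      ((c.app (op V)).hom t) = 0 :=
    ConcreteCategory.congr_hom (NatTrans.congr_app h1 (op V)) t
  -- The class of `t` in the presheaf cokernel dies in the sheafification, so it already vanishes on
  -- a covering sieve; exactness over each open set then gives the lift.
  have h2 := Presheaf.equalizerSieve_mem (Opens.grothendieckTopology X)
    (CategoryTheory.toSheafify (Opens.grothendieckTopology X) P.presheaf) (X := op V)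
    ((c.app (op V)).hom t) 0 (h1'.trans (map_zero _).symm)
  obtain ⟨W, i, hi, hyW⟩ := h2 y hy
  have h3 : (c.app (op W)).hom (res N (leOfHom i) t) = 0 := by
    refine (PresheafOfModules.naturality_apply c i.op t).trans ?_
    exact hi.trans (map_zero _)
  have h4 : ((ShortComplex.mk _ _ (cokernel.condition (G.map q'))).map
      (PresheafOfModules.evaluation X.ringCatSheaf.obj (op W))).Exact :=
    (ShortComplex.exact_of_g_is_cokernel _
      (cokernelIsCokernel (G.map q'))).map_of_epi_of_preservesCokernel _
      inferInstance inferInstance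
  rw [ShortComplex.moduleCat_exact_iff] at h4
  obtain ⟨s, hs⟩ := h4 (res N (leOfHom i) t) h3
  exact ⟨W, leOfHom i, s, hyW, hs⟩

/-! ### Coherence of images and of zero sheaves. -/

theorem res_res (M : X.Modules) {U V W : X.Opens} (h : V ≤ U) (h' : W ≤ V) (s : Γ(M, U)) :
    res M h' (res M h s) = res M (h'.trans h) s := by
  simp only [res]
  rw [← ConcreteCategory.comp_apply, ← Functor.map_comp]
  rfl

theorem app_res {M N : X.Modules} (f : M ⟶ N) {U V : X.Opens} (h : V ≤ U) (s : Γ(M, U)) :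
    f.app V (res M h s) = res N h (f.app U s) :=
  ConcreteCategory.congr_hom (f.mapPresheaf.naturality (homOfLE h).op) s

theorem app_sum_smul_res {M N : X.Modules} (f : M ⟶ N) {U V : X.Opens} (h : V ≤ U) {k : ℕ}
    (a : Fin k → Γ(X, V)) (s : Fin k → Γ(M, U)) :
    f.app V (∑ i, a i • res M h (s i)) = ∑ i, a i • res N h (f.app U (s i)) := by
  simp only [map_sum, Scheme.Modules.Hom.app_smul, app_res]

theorem app_injective_of_mono {M N : X.Modules} (f : M ⟶ N) [Mono f] (U : X.Opens) :
    Function.Injective (f.app U) := by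
  have h : Mono ((Scheme.Modules.toPresheaf X).map f) := inferInstance
  rw [NatTrans.mono_iff_mono_app] at h
  exact (AddCommGrpCat.mono_iff_injective _).1 (h (op U))

theorem IsOfFiniteType.of_epi {M N : X.Modules} (hM : IsOfFiniteType M) (q : M ⟶ N) [Epi q] :
    IsOfFiniteType N := by
  intro x
  obtain ⟨U, k, s, hx, hs⟩ := hM x
  refine ⟨U, k, fun i => q.app U (s i), hx, fun V hV t y hy => ?_⟩
  obtain ⟨W, hW, t', hyW, ht'⟩ := exists_local_lift_of_epi q t hy
  obtain ⟨W', hW', a, hyW', ha⟩ := hs W (hW.trans hV) t' y hyW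
  refine ⟨W', hW'.trans hW, a, hyW', ?_⟩
  rw [← res_res N hW hW', ← ht', ← app_res, ha, app_sum_smul_res]

theorem HasFiniteRelations.of_mono {M N : X.Modules} (hN : HasFiniteRelations N) (f : M ⟶ N)
    [Mono f] : HasFiniteRelations M := by
  intro U k s x hx
  obtain ⟨V, hV, m, r, hxV, hr, h⟩ := hN U k (fun i => f.app U (s i)) x hx
  refine ⟨V, hV, m, r, hxV, fun j => app_injective_of_mono f V ?_, fun W hW a ha y hy =>
    h W hW a ?_ y hy⟩
  · rw [app_sum_smul_res, hr, map_zero]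
  · rw [← app_sum_smul_res, ha, map_zero]

/-- The two halves of coherence come from different sides: finite type passes to the quotient of
`M`, finiteness of relations to the submodule of `N`. -/
theorem IsCoherent.image {M N : X.Modules} (hM : IsCoherent M) (hN : IsCoherent N) (f : M ⟶ N) :
    IsCoherent (image f) :=
  ⟨hM.1.of_epi (factorThruImage f), hN.2.of_mono (image.ι f)⟩

theorem isCoherent_of_isZero {M : X.Modules} (hM : IsZero M) : IsCoherent M := by
  have h (U : X.Opens) (s : Γ(M, U)) : s = 0 :=
    ConcreteCategory.congr_hom (congrArg (fun f : M ⟶ M => f.app U) (hM.eq_of_src (𝟙 M) 0)) s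
  -- Every tuple is a relation, so the rows of the identity matrix generate, with the tuple itself
  -- as coefficients.
  refine ⟨fun x => ⟨⊤, 0, Fin.elim0, trivial, fun V hV t y hy =>
    ⟨V, le_rfl, Fin.elim0, hy, h _ _⟩⟩, fun U k s x hx => ⟨U, le_rfl, k, fun j i => if i = j then 1
      else 0, hx, fun _ => h _ _, fun W hW a _ y hy => ⟨W, le_rfl, a, hy, fun i => ?_⟩⟩⟩
  simp [resFun, apply_ite]

/-! ### Stable sheaves -/

theorem PolyLT.irrefl (P : ℚ[X]) : ¬ PolyLT P P := by
  rintro (h | ⟨-, h⟩)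
  · exact lt_irrefl _ h
  · obtain ⟨t, ht⟩ := h.exists
    exact lt_irrefl _ ht

theorem PolyLT.trans {P Q R : ℚ[X]} (h : PolyLT P Q) (h' : PolyLT Q R) : PolyLT P R := by
  rcases h with h | ⟨h, hl⟩ <;> rcases h' with h' | ⟨h', hl'⟩
  · exact .inl (h'.trans h)
  · exact .inl (h' ▸ h)
  · exact .inl (h ▸ h')
  · exact .inr ⟨h.trans h', (hl.and hl').mono fun t ht => ht.1.trans ht.2⟩

variable {T : PolarizedThreefold}

/-- Schur's lemma for stable sheaves with the same reduced Hilbert polynomial. -/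
theorem GiesekerStable.isIso_of_ne_zero {F G : T.X.Modules} (hF : GiesekerStable T F)
    (hG : GiesekerStable T G) (h : redHilb T F = redHilb T G) {f : F ⟶ G} (hf : f ≠ 0) :
    IsIso f := by
  have hI : IsCoherent (image f) := hF.1.image hG.1 f
  have hI0 : ¬ IsZero (image f) := fun h0 => hf <| by
    rw [← image.fac f, h0.eq_of_src (image.ι f) 0, Limits.comp_zero]
  by_contra hiso
  by_cases hm : Mono f
  · exact PolyLT.irrefl _ (h ▸ hG.2.2.1 F f hF.1 hF.2.1 hm hiso)
  by_cases he : Epi f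
  · exact PolyLT.irrefl _ (h ▸ hF.2.2.2 G f hG.1 hG.2.1 he hiso)
  -- With `f` neither mono nor epi, the image is a proper quotient of `F` and a proper subsheaf of
  -- `G`, so its polynomial would lie strictly between two equal ones.
  have h1 : PolyLT (redHilb T F) (redHilb T (image f)) :=
    hF.2.2.2 _ (factorThruImage f) hI hI0 inferInstance fun _ =>
      hm (image.fac f ▸ inferInstance)
  have h2 : PolyLT (redHilb T (image f)) (redHilb T G) :=
    hG.2.2.1 _ (image.ι f) hI hI0 inferInstance fun _ =>
      he (image.fac f ▸ epi_comp _ _)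
  exact PolyLT.irrefl _ (h ▸ h1.trans h2)

theorem InAp.redHilb_eq {p : ℚ[X]} {F : T.X.Modules} (hF : InAp T p F) (h : ¬ IsZero F) :
    redHilb T F = p :=
  (hF.2.resolve_left h).2

theorem InAp.of_isZero {p : ℚ[X]} {F : T.X.Modules} (h : IsZero F) : InAp T p F :=
  ⟨isCoherent_of_isZero h, .inl h⟩

/-- A nonzero morphism between objects of `𝒜_p` that are zero or stable is an isomorphism. -/
theorem InAp.isIso_of_ne_zero {p : ℚ[X]} {F G : T.X.Modules} (hF : InAp T p F) (hG : InAp T p G)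
    (hF' : IsZero F ∨ GiesekerStable T F) (hG' : IsZero G ∨ GiesekerStable T G) {f : F ⟶ G}
    (hf : f ≠ 0) : IsIso f := by
  have h1 : ¬ IsZero F := fun h => hf (h.eq_of_src _ _)
  have h2 : ¬ IsZero G := fun h => hf (h.eq_of_tgt _ _)
  exact (hF'.resolve_left h1).isIso_of_ne_zero (hG'.resolve_left h2)
    ((hF.redHilb_eq h1).trans (hG.redHilb_eq h2).symm) hf

/-! ### Numerical classes -/

theorem sheafClass_eq_add {S F Q : T.X.Modules} (hS : IsCoherent S) (hF : IsCoherent F)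
    (hQ : IsCoherent Q) {i : S ⟶ F} {q : F ⟶ Q} (w : i ≫ q = 0)
    (h : (ShortComplex.mk i q w).ShortExact) :
    sheafClass T F hF = sheafClass T S hS + sheafClass T Q hQ := by
  rw [sheafClass, sheafClass, sheafClass, ← QuotientAddGroup.mk_add, eq_comm, QuotientAddGroup.eq]
  refine (le_sup_left : exactRelations T ≤ _) (AddSubgroup.subset_closure
    ⟨⟨S, hS⟩, ⟨F, hF⟩, ⟨Q, hQ⟩, i, q, w, h, ?_⟩)
  abel

theorem shortExact_of_isIso_of_isZero {S F Q : T.X.Modules} (i : S ⟶ F) [IsIso i] (hQ : IsZero Q) :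
    (ShortComplex.mk i (0 : F ⟶ Q) Limits.comp_zero).ShortExact where
  exact := (ShortComplex.exact_iff_epi _ rfl).2 inferInstance
  mono_f := inferInstanceAs (Mono i)
  epi_g := ⟨fun _ _ _ => hQ.eq_of_src _ _⟩

theorem shortExact_of_isZero_of_isIso {S F Q : T.X.Modules} (q : F ⟶ Q) [IsIso q]
    (hS : IsZero S) : (ShortComplex.mk (0 : S ⟶ F) q Limits.zero_comp).ShortExact where
  exact := (ShortComplex.exact_iff_mono _ rfl).2 (inferInstanceAs (Mono q))
  mono_f := ⟨fun _ _ _ => hS.eq_of_tgt _ _⟩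
  epi_g := inferInstanceAs (Epi q)

theorem sheafClass_of_isZero {F : T.X.Modules} (hF : IsCoherent F) (h : IsZero F) :
    sheafClass T F hF = 0 := by
  -- For a zero sheaf, `0 → F → F → F → 0` is short exact, whence `[F] = [F] + [F]`.
  have := sheafClass_eq_add hF hF hF _ (shortExact_of_isIso_of_isZero (𝟙 F) h)
  simpa using this

theorem sheafClass_eq_of_iso {F G : T.X.Modules} (hF : IsCoherent F) (hG : IsCoherent G)
    (f : F ≅ G) : sheafClass T F hF = sheafClass T G hG := by
  obtain ⟨Z, h0⟩ := HasZeroObject.zero (C := T.X.Modules)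
  rw [sheafClass_eq_add hF hG (isCoherent_of_isZero h0) _ (shortExact_of_isIso_of_isZero f.hom h0),
    sheafClass_of_isZero _ h0, add_zero]

variable {n : ℤ} {p : ℚ[X]}

/-! ### Morphisms and isomorphisms of `ℬ_p`. -/

namespace Bp

@[simp] theorem comp_f {E E' E'' : Bp T n p} (a : E ⟶ E') (b : E' ⟶ E'') :
    (a ≫ b).f = a.f ≫ b.f := rfl

@[simp] theorem comp_g {E E' E'' : Bp T n p} (a : E ⟶ E') (b : E' ⟶ E'') :
    (a ≫ b).g = b.g.comp a.g := rfl

@[simp] theorem id_f (E : Bp T n p) : Hom.f (𝟙 E) = 𝟙 E.F := rfl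

@[simp] theorem id_g (E : Bp T n p) : Hom.g (𝟙 E) = LinearMap.id := rfl

theorem hom_ext {E E' : Bp T n p} {a b : E ⟶ E'} (hf : a.f = b.f) (hg : a.g = b.g) : a = b :=
  Hom.ext hf hg

/-- An isomorphism of `ℬ_p` from an isomorphism of sheaves and one of vector spaces. -/
def isoMk {E E' : Bp T n p} (f : E.F ≅ E'.F) (g : E.V ≃ₗ[ℂ] E'.V)
    (comm : ∀ v, E'.φ (g v) = E.φ v ≫ f.hom) : E ≅ E' where
  hom := ⟨f.hom, g, comm⟩
  inv := ⟨f.inv, g.symm, fun v => by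
    rw [Iso.eq_comp_inv, ← comm, LinearEquiv.coe_coe, LinearEquiv.apply_symm_apply]⟩
  hom_inv_id := hom_ext f.hom_inv_id (by ext; simp)
  inv_hom_id := hom_ext f.inv_hom_id (by ext; simp)

theorem isIso_of_isIso_of_bijective {E E' : Bp T n p} (a : E ⟶ E') (hf : IsIso a.f)
    (hg : Function.Bijective a.g) : IsIso a := by
  have h := (isoMk (asIso a.f) (LinearEquiv.ofBijective a.g hg) a.comm).isIso_hom
  exact h

/-- The isomorphism of sheaves underlying an isomorphism of `ℬ_p`. -/
def sheafIso {E E' : Bp T n p} (a : E ≅ E') : E.F ≅ E'.F where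
  hom := a.hom.f
  inv := a.inv.f
  hom_inv_id := congrArg Hom.f a.hom_inv_id
  inv_hom_id := congrArg Hom.f a.inv_hom_id

/-- The isomorphism of vector spaces underlying an isomorphism of `ℬ_p`. -/
def linearEquiv {E E' : Bp T n p} (a : E ≅ E') : E.V ≃ₗ[ℂ] E'.V :=
  LinearEquiv.ofLinearMap a.hom.g a.inv.g (congrArg Hom.g a.inv_hom_id) (congrArg Hom.g a.hom_inv_id)

theorem cls_fst_eq_of_iso {E E' : Bp T n p} (a : E ≅ E') : E.cls.1 = E'.cls.1 :=
  sheafClass_eq_of_iso _ _ (sheafIso a)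

theorem nonempty_iso_of_isZero {E E' : Bp T n p} (h : IsZero E.F) (h' : IsZero E'.F)
    (hr : E.cls.2 = E'.cls.2) : Nonempty (E ≅ E') :=
  ⟨isoMk (h.iso h') (LinearEquiv.ofFinrankEq _ _ (by simpa [cls] using hr))
    fun _ => h'.eq_of_tgt _ _⟩

/-! ### Stable objects of rank one -/

theorem finrank_eq_one {E : Bp T n p} (h : E.cls.2 = 1) : Module.finrank ℂ E.V = 1 := by
  simpa [cls] using h

theorem isSimpleModule {E : Bp T n p} (h : E.cls.2 = 1) : IsSimpleModule ℂ E.V :=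
  isSimpleModule_iff_finrank_eq_one.2 (finrank_eq_one h)

/-- If `φ = 0`, the sub-object `(0, V)` of `(F, V, φ)` contradicts stability. -/
theorem Stable.φ_ne_zero {E : Bp T n p} (hE : E.Stable) (hr : E.cls.2 = 1) (hF : ¬ IsZero E.F) :
    E.φ ≠ 0 := by
  intro h
  obtain ⟨Z, h0⟩ := HasZeroObject.zero (C := T.X.Modules)
  have := isSimpleModule hr
  have hV : Nontrivial E.V := IsSimpleModule.nontrivial ℂ E.V
  let S : Bp T n p := ⟨Z, .of_isZero h0, E.V, 0⟩
  let Q : Bp T n p := ⟨E.F, E.inAp, PUnit, 0⟩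
  let i : S ⟶ E := ⟨0, LinearMap.id, fun v => by simp [S, h]⟩
  let q : E ⟶ Q := ⟨𝟙 _, 0, fun v => by simp [Q, h]⟩
  have hex : IsShortExact i q := by
    refine ⟨⟨Limits.zero_comp, shortExact_of_isZero_of_isIso (𝟙 E.F) h0⟩,
      Function.injective_id, fun v => ?_, fun v => ⟨0, Subsingleton.elim _ _⟩⟩
    exact ⟨fun _ => ⟨v, rfl⟩, fun _ => rfl⟩
  -- The quotient `(F, 0)` has `τ̃ = 0`, and no natural number is smaller.
  have hlt := hE.2 S Q i q hex (fun hS => not_subsingleton E.V hS.2) (fun hQ => hF hQ.1)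
  have hQ : Q.cls.2 = 0 := by
    simp [cls, Q, Module.finrank_zero_of_subsingleton]
  simp [tauTilde, hQ] at hlt

/-- `V` is a line, so a nonzero linear map out of it is injective. -/
theorem Stable.φ_injective {E : Bp T n p} (hE : E.Stable) (hr : E.cls.2 = 1)
    (hF : ¬ IsZero E.F) : Function.Injective E.φ := by
  have := isSimpleModule hr
  exact (LinearMap.injective_or_eq_zero E.φ).resolve_right (hE.φ_ne_zero hr hF)

/-- Schur's lemma for `τ̃`-stable objects of rank one whose sheaves are zero or stable. -/
theorem Stable.isIso_or_eq_zero {E E' : Bp T n p} (hE : E.Stable) (hE' : E'.Stable)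
    (hr : E.cls.2 = 1) (hr' : E'.cls.2 = 1) (hF : IsZero E.F ∨ GiesekerStable T E.F)
    (hF' : IsZero E'.F ∨ GiesekerStable T E'.F) (a : E ⟶ E') :
    IsIso a ∨ (a.f = 0 ∧ a.g = 0) ∨ (¬ IsZero E.F ∧ IsZero E'.F) := by
  have := isSimpleModule hr
  have := isSimpleModule hr'
  have hV : Nontrivial E.V := IsSimpleModule.nontrivial ℂ E.V
  obtain ⟨v, hv⟩ := exists_ne (0 : E.V)
  rcases LinearMap.bijective_or_eq_zero a.g with hg | hg
  · by_cases hf : IsIso a.f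
    · exact .inl (isIso_of_isIso_of_bijective a hf hg)
    have hf0 : a.f = 0 := by
      by_contra h
      exact hf (E.inAp.isIso_of_ne_zero E'.inAp hF hF' h)
    have hz' : IsZero E'.F := by
      -- If `E'.F` were nonzero, `φ'` would be injective, yet it would kill the nonzero vector `a.g
      -- v`.
      by_contra h
      have h1 := a.comm v
      rw [hf0, Limits.comp_zero] at h1
      have h2 := hE'.φ_injective hr' h (h1.trans (map_zero _).symm)
      exact hv (hg.1 (h2.trans (map_zero _).symm))
    refine .inr (.inr ⟨fun h => hf ?_, hz'⟩)
    have h3 : a.f = (h.iso hz').hom := h.eq_of_src _ _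
    rw [h3]
    infer_instance
  · refine .inr (.inl ⟨?_, hg⟩)
    -- A nonzero `a.f` is invertible, and compatibility with `a.g = 0` then forces `φ v = 0`,
    -- against injectivity of `φ`.
    by_contra h
    have hiso := E.inAp.isIso_of_ne_zero E'.inAp hF hF' h
    have h1 := a.comm v
    rw [hg, LinearMap.zero_apply, map_zero, eq_comm] at h1
    have h2 : E.φ v = 0 := zero_of_comp_mono a.f h1
    exact hv (hE.φ_injective hr (fun hz => h (hz.eq_of_src _ _)) (h2.trans (map_zero _).symm))

/-! ### Short exact sequences -/

section ShortExact

variable {S E Q : Bp T n p} {i : S ⟶ E} {q : E ⟶ Q}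

/-- The sheaf part and the linear part lift separately; their compatibility with `φ` can be checked
after composing with the monomorphism `i.f`. -/
theorem IsShortExact.exists_lift (h : IsShortExact i q) {A : Bp T n p} (a : A ⟶ E)
    (hf : (a ≫ q).f = 0) (hg : (a ≫ q).g = 0) : ∃ b : A ⟶ S, b ≫ i = a := by
  obtain ⟨⟨w, hs⟩, hi, hex, -⟩ := h
  have : Mono i.f := hs.mono_f
  have hk (v : A.V) : ∃ s, i.g s = a.g v := (hex _).1 (LinearMap.congr_fun hg v)
  let f : A.F ⟶ S.F := hs.fIsKernel.lift (KernelFork.ofι a.f hf)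
  have hf' : f ≫ i.f = a.f := hs.fIsKernel.fac _ WalkingParallelPair.zero
  let g : A.V →ₗ[ℂ] S.V := (LinearEquiv.ofInjective i.g hi).symm.toLinearMap.comp
    (a.g.codRestrict (LinearMap.range i.g) hk)
  have hg' (v : A.V) : i.g (g v) = a.g v :=
    congrArg Subtype.val ((LinearEquiv.ofInjective i.g hi).apply_symm_apply ⟨a.g v, hk v⟩)
  refine ⟨⟨f, g, fun v => ?_⟩, hom_ext hf' (LinearMap.ext hg')⟩
  rw [← cancel_mono i.f, ← i.comm, hg', a.comm, Category.assoc, hf']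

/-- Dual to `exists_lift`: both parts descend separately, and compatibility is checked on vectors
`q.g v`, which suffices because `q.g` is surjective. -/
theorem IsShortExact.exists_desc (h : IsShortExact i q) {A : Bp T n p} (a : E ⟶ A)
    (hf : (i ≫ a).f = 0) (hg : (i ≫ a).g = 0) : ∃ b : Q ⟶ A, q ≫ b = a := by
  obtain ⟨⟨w, hs⟩, -, hex, hq⟩ := h
  let f : Q.F ⟶ A.F := hs.gIsCokernel.desc (CokernelCofork.ofπ a.f hf)
  have hf' : q.f ≫ f = a.f := hs.gIsCokernel.fac _ WalkingParallelPair.one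
  have hk : LinearMap.ker q.g ≤ LinearMap.ker a.g := fun v hv => by
    obtain ⟨s, rfl⟩ := (hex v).1 hv
    exact LinearMap.congr_fun hg s
  let g : Q.V →ₗ[ℂ] A.V := ((LinearMap.ker q.g).liftQ a.g hk).comp
    (q.g.quotKerEquivOfSurjective hq).symm.toLinearMap
  have hg' (v : E.V) : g (q.g v) = a.g v := by
    have : (q.g.quotKerEquivOfSurjective hq).symm (q.g v) = Submodule.Quotient.mk v := by
      rw [LinearEquiv.symm_apply_eq]; rfl
    change (LinearMap.ker q.g).liftQ a.g hk ((q.g.quotKerEquivOfSurjective hq).symm (q.g v)) = _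
    rw [this]; rfl
  refine ⟨⟨f, g, fun v => ?_⟩, hom_ext hf' (LinearMap.ext hg')⟩
  obtain ⟨v, rfl⟩ := hq v
  rw [hg', q.comm, a.comm, Category.assoc, hf']

theorem IsShortExact.epi (h : IsShortExact i q) : Epi q := by
  obtain ⟨⟨w, hs⟩, -, -, hq⟩ := h
  have : Epi q.f := hs.epi_g
  refine ⟨fun a b hab => hom_ext ?_ ?_⟩
  · rw [← cancel_epi q.f]
    exact congrArg Hom.f hab
  · ext v
    obtain ⟨v, rfl⟩ := hq v
    exact LinearMap.congr_fun (congrArg Hom.g hab) v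

theorem IsShortExact.comp_f_eq_zero (h : IsShortExact i q) : (i ≫ q).f = 0 := h.1.1

theorem IsShortExact.comp_g_eq_zero (h : IsShortExact i q) : (i ≫ q).g = 0 :=
  LinearMap.ext fun v => (h.2.2.1 _).2 ⟨v, rfl⟩

theorem IsShortExact.mono_f (h : IsShortExact i q) : Mono i.f := h.1.2.mono_f

theorem IsShortExact.isIso_f_iff (h : IsShortExact i q) : IsIso i.f ↔ IsZero Q.F :=
  h.1.2.isIso_f_iff

theorem IsShortExact.comp_iso (h : IsShortExact i q) {E' : Bp T n p} (a : E ≅ E') :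
    IsShortExact (i ≫ a.hom) (a.inv ≫ q) := by
  obtain ⟨⟨w, hs⟩, hi, hex, hq⟩ := h
  have hid : a.hom.f ≫ a.inv.f = 𝟙 _ := (sheafIso a).hom_inv_id
  have hid' (v : E.V) : a.inv.g (a.hom.g v) = v := (linearEquiv a).symm_apply_apply v
  have hid'' (v : E'.V) : a.hom.g (a.inv.g v) = v := (linearEquiv a).apply_symm_apply v
  refine ⟨⟨by simp [reassoc_of% hid, w], ShortComplex.shortExact_of_iso
    (S₁ := ShortComplex.mk i.f q.f w) (ShortComplex.isoMk
    (Iso.refl _) (sheafIso a) (Iso.refl _) ?_ ?_) hs⟩, (linearEquiv a).injective.comp hi, ?_,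
    hq.comp (linearEquiv a).symm.surjective⟩
  · simp [sheafIso]
  · simp [sheafIso, reassoc_of% hid]
  · intro v
    refine (hex (a.inv.g v)).trans ⟨fun ⟨s, hs⟩ => ⟨s, ?_⟩, fun ⟨s, hs⟩ => ⟨s, ?_⟩⟩
    · simp [hs, hid'']
    · simp [← hs, hid']

end ShortExact

/-! ### Comparison of two extensions of the same object. -/

namespace StableExtension

variable {E₂ : Bp T n p} {β : Knum T}

theorem type_eq {E₂' : Bp T n p} (e : StableExtension E₂) (e' : StableExtension E₂')
    (h₁ : Nonempty (e.E₁.F ≅ e'.E₁.F)) (h₃ : Nonempty (e.E₃ ≅ e'.E₃)) : e'.type = e.type :=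
  Prod.ext (sheafClass_eq_of_iso _ _ h₁.some.symm) (cls_fst_eq_of_iso h₃.some.symm)

theorem isZero_or_stable₁ (e : StableExtension E₂) (he : e.type ∈ decompositions T p β) :
    IsZero e.E₁.F ∨ GiesekerStable T e.E₁.F :=
  he.2.1 _ e.E₁.inAp rfl

theorem isZero_or_stable₃ (e : StableExtension E₂) (he : e.type ∈ decompositions T p β) :
    IsZero e.E₃.F ∨ GiesekerStable T e.E₃.F :=
  he.2.2 _ e.E₃.inAp rfl

/-- If one of two extensions of the same object is non-split, then either they have the same
sub-object, or the sheaves of both sub-objects are nonzero and map isomorphically to that of the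
object. -/
theorem same_subobject_or_isIso (e e' : StableExtension E₂)
    (he : e.type ∈ decompositions T p β) (he' : e'.type ∈ decompositions T p β)
    (hns : ¬ e.IsSplit) :
    (∃ (a : e.E₁ ≅ e'.E₁) (b : e.E₃ ≅ e'.E₃), a.hom ≫ e'.ι = e.ι ∧ e.π ≫ b.hom = e'.π) ∨
      (¬ IsZero e.E₁.F ∧ ¬ IsZero e'.E₁.F ∧ IsIso e.ι.f ∧ IsIso e'.ι.f) := by
  rcases e.stable₁.isIso_or_eq_zero e'.stable₃ e.rank₁ e'.rank₃ (e.isZero_or_stable₁ he)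
    (e'.isZero_or_stable₃ he') (e.ι ≫ e'.π) with h | ⟨hf, hg⟩ | ⟨h₁, h₃⟩
  -- An invertible composite yields the retraction `e'.π ≫ inv (e.ι ≫ e'.π)` of `e.ι`.
  · exact absurd (IsSplitMono.mk' ⟨e'.π ≫ inv (e.ι ≫ e'.π), by
      rw [← Category.assoc, IsIso.hom_inv_id]⟩) hns
  · left
    obtain ⟨a, ha⟩ := e'.exact.exists_lift e.ι hf hg
    have hai : IsIso a := by
      have hmf : Mono a.f := by
        have := e.exact.mono_f
        have h : a.f ≫ e'.ι.f = e.ι.f := congrArg Hom.f ha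
        exact mono_of_mono_fac h
      have hmg : Function.Injective a.g := by
        have h : e'.ι.g ∘ a.g = e.ι.g := congrArg (fun x : e.E₁ ⟶ E₂ => ⇑x.g) ha
        exact Function.Injective.of_comp (f := e'.ι.g) (h ▸ e.exact.2.1)
      rcases e.stable₁.isIso_or_eq_zero e'.stable₁ e.rank₁ e'.rank₁ (e.isZero_or_stable₁ he)
        (e'.isZero_or_stable₁ he') a with h | ⟨-, h⟩ | ⟨h, h'⟩
      · exact h
      · have := isSimpleModule e.rank₁
        have := IsSimpleModule.nontrivial ℂ e.E₁.V
        obtain ⟨v, hv⟩ := exists_ne (0 : e.E₁.V)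
        exact absurd (hmg (by simp [h])) hv
      -- The exceptional alternative is impossible here, since `a.f` embeds the nonzero `E₁.F` in
      -- `E₁'.F`.
      · exact absurd (IsZero.of_mono a.f h') h
    obtain ⟨b, hb⟩ := e.exact.exists_desc e'.π hf hg
    have hι : e'.ι ≫ e.π = inv a ≫ e.ι ≫ e.π := by rw [← ha]; simp
    obtain ⟨c, hc⟩ := e'.exact.exists_desc e.π
      (by rw [hι, comp_f, e.exact.comp_f_eq_zero, Limits.comp_zero])
      (by rw [hι, comp_g, e.exact.comp_g_eq_zero, LinearMap.zero_comp])
    have := e.exact.epi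
    have := e'.exact.epi
    exact ⟨asIso a, ⟨b, c, by rw [← cancel_epi e.π]; simp [reassoc_of% hb, hc],
      by rw [← cancel_epi e'.π]; simp [reassoc_of% hc, hb]⟩, ha, hb⟩
  · right
    have hi' : IsIso e'.ι.f := e'.exact.isIso_f_iff.2 h₃
    have hm := e.exact.mono_f
    -- This comparison of `E₁.F` with `E₁'.F` is a monomorphism out of a nonzero sheaf, so Schur's
    -- lemma for sheaves makes it, and then `e.ι.f`, invertible.
    have hn : e.ι.f ≫ inv e'.ι.f ≠ 0 := fun h => h₁ (IsZero.of_mono_eq_zero _ h)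
    have hi := e.E₁.inAp.isIso_of_ne_zero e'.E₁.inAp (e.isZero_or_stable₁ he)
      (e'.isZero_or_stable₁ he') hn
    refine ⟨h₁, fun h => hn (h.eq_of_tgt _ _), ?_, hi'⟩
    exact IsIso.of_isIso_comp_right e.ι.f (inv e'.ι.f)

/-- The sheaf part of a retraction must be `inv e.ι.f`. After transport along it, the range
condition puts the sections of `E₂` in the range of the injective `E₁.φ`, so a left inverse of
`E₁.φ` supplies the linear part. -/
theorem isSplit_of_range_le (e : StableExtension E₂) (h : ¬ IsZero e.E₁.F) (hi : IsIso e.ι.f)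
    (hr : LinearMap.range E₂.φ ≤ LinearMap.range (E₂.φ.comp e.ι.g)) : e.IsSplit := by
  have hinj := e.stable₁.φ_injective e.rank₁ h
  obtain ⟨l, hl⟩ := e.E₁.φ.exists_leftInverse_of_injective (LinearMap.ker_eq_bot.2 hinj)
  have hl' (v : e.E₁.V) : l (e.E₁.φ v) = v := LinearMap.congr_fun hl v
  have hι (v : e.E₁.V) : E₂.φ (e.ι.g v) ≫ inv e.ι.f = e.E₁.φ v := by
    rw [e.ι.comm, Category.assoc, IsIso.hom_inv_id, Category.comp_id]
  have hlift (v : E₂.V) : ∃ w, E₂.φ (e.ι.g w) = E₂.φ v := hr ⟨v, rfl⟩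
  let r : E₂ ⟶ e.E₁ := ⟨inv e.ι.f, l.comp ((Linear.rightComp ℂ _ (inv e.ι.f)).comp E₂.φ),
    fun v => by
      obtain ⟨w, hw⟩ := hlift v
      simp only [LinearMap.comp_apply, Linear.rightComp_apply]
      rw [← hw, hι, hl']⟩
  refine IsSplitMono.mk' ⟨r, hom_ext (IsIso.hom_inv_id _) (LinearMap.ext fun v => ?_)⟩
  change l (E₂.φ (e.ι.g v) ≫ inv e.ι.f) = v
  rw [hι, hl']

theorem range_eq_of_isSplit (e : StableExtension E₂) (hi : IsIso e.ι.f) (hs : e.IsSplit) :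
    LinearMap.range E₂.φ = LinearMap.range (E₂.φ.comp e.ι.g) := by
  obtain ⟨⟨r, hr⟩⟩ := hs
  refine le_antisymm ?_ (LinearMap.range_comp_le_range _ _)
  rintro _ ⟨v, rfl⟩
  refine ⟨r.g v, ?_⟩
  have h1 : e.ι.f ≫ r.f = 𝟙 _ := congrArg Hom.f hr
  have h2 : r.f ≫ e.ι.f = 𝟙 _ := by
    rw [← cancel_epi e.ι.f, reassoc_of% h1, Category.comp_id]
  rw [LinearMap.comp_apply, e.ι.comm, r.comm, Category.assoc, h2, Category.comp_id]

/-- If `e'` split, `E₂.φ` would have rank at most one. The sections coming from `E₁` already span a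
line, so they would exhaust the range of `E₂.φ`, and `e` would split as well. -/
theorem not_isSplit_of_isIso (e e' : StableExtension E₂) (h : ¬ IsZero e.E₁.F)
    (hi : IsIso e.ι.f) (hi' : IsIso e'.ι.f) (hns : ¬ e.IsSplit) : ¬ e'.IsSplit := by
  intro hs
  refine hns (e.isSplit_of_range_le h hi (Submodule.eq_of_le_of_finrank_le
    (LinearMap.range_comp_le_range _ _) ?_).ge)
  have hinj : Function.Injective (E₂.φ.comp e.ι.g) := by
    intro v w hvw
    apply e.stable₁.φ_injective e.rank₁ h
    rw [← cancel_mono e.ι.f, ← e.ι.comm, ← e.ι.comm]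
    exact hvw
  rw [e'.range_eq_of_isSplit hi' hs, LinearMap.finrank_range_of_inj hinj, finrank_eq_one e.rank₁,
    ← finrank_eq_one e'.rank₁]
  exact LinearMap.finrank_range_le _

/-- The uniqueness properties of non-split extensions. -/
theorem uniqueness (e e' : StableExtension E₂)
    (he : e.type ∈ decompositions T p β) (he' : e'.type ∈ decompositions T p β)
    (hns : ¬ e.IsSplit) :
    e'.type = e.type ∧ ¬ e'.IsSplit ∧ Nonempty (e.E₁.F ≅ e'.E₁.F) ∧ Nonempty (e.E₃ ≅ e'.E₃) ∧
      (¬ IsZero e.E₃.F → ∃ (a : e.E₁ ≅ e'.E₁) (b : e.E₃ ≅ e'.E₃),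
        a.hom ≫ e'.ι = e.ι ∧ e.π ≫ b.hom = e'.π) := by
  rcases e.same_subobject_or_isIso e' he he' hns with ⟨a, b, ha, hb⟩ | ⟨h, h', hi, hi'⟩
  · have h₁ : Nonempty (e.E₁.F ≅ e'.E₁.F) := ⟨sheafIso a⟩
    refine ⟨e.type_eq e' h₁ ⟨b⟩, fun hs => hns ?_, h₁, ⟨b⟩, fun _ => ⟨a, b, ha, hb⟩⟩
    obtain ⟨⟨r, hr⟩⟩ := hs
    exact IsSplitMono.mk' ⟨r ≫ a.inv, by rw [← ha]; simp [reassoc_of% hr]⟩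
  · have h₁ : Nonempty (e.E₁.F ≅ e'.E₁.F) := ⟨asIso e.ι.f ≪≫ (asIso e'.ι.f).symm⟩
    -- Both quotients have zero sheaf, so equality of ranks makes them isomorphic, and the final
    -- clause is vacuous.
    have hz := e.exact.isIso_f_iff.1 hi
    have h₃ := nonempty_iso_of_isZero hz (e'.exact.isIso_f_iff.1 hi')
      (e.rank₃.trans e'.rank₃.symm)
    exact ⟨e.type_eq e' h₁ h₃, e.not_isSplit_of_isIso e' h hi hi' hns, h₁, h₃,
      fun hn => absurd hz hn⟩

/-- This makes the division into `stratumOne` and `stratumTwo` independent of the chosen extension.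
If `E₃.F = 0`, all four end sheaves vanish and only ranks matter; otherwise the two extensions have
isomorphic ends. -/
theorem endsIsomorphic_of_not_isSplit (e e' : StableExtension E₂)
    (he : e.type ∈ decompositions T p β) (he' : e'.type ∈ decompositions T p β)
    (hns : ¬ e.IsSplit) (h : e.EndsIsomorphic) : e'.EndsIsomorphic := by
  obtain ⟨-, -, ⟨f⟩, ⟨b⟩, hab⟩ := e.uniqueness e' he he' hns
  obtain ⟨c⟩ := h
  by_cases hz : IsZero e.E₃.F
  · exact nonempty_iso_of_isZero ((hz.of_iso (sheafIso c)).of_iso f.symm)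
      (hz.of_iso (sheafIso b).symm) (e'.rank₁.trans e'.rank₃.symm)
  · obtain ⟨a, -, -, -⟩ := hab hz
    exact ⟨a.symm ≪≫ c ≪≫ b⟩

/-- The extension obtained from an isomorphism of the middle objects. -/
def transport {E₂' : Bp T n p} (e : StableExtension E₂) (a : E₂ ≅ E₂') : StableExtension E₂' where
  E₁ := e.E₁
  E₃ := e.E₃
  ι := e.ι ≫ a.hom
  π := a.inv ≫ e.π
  exact := e.exact.comp_iso a
  stable₁ := e.stable₁
  stable₃ := e.stable₃
  rank₁ := e.rank₁
  rank₃ := e.rank₃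

theorem isSplit_of_transport {E₂' : Bp T n p} (e : StableExtension E₂) (a : E₂ ≅ E₂')
    (h : (e.transport a).IsSplit) : e.IsSplit := by
  obtain ⟨⟨r, hr⟩⟩ := h
  exact IsSplitMono.mk' ⟨a.hom ≫ r, (Category.assoc _ _ _).symm.trans hr⟩

end StableExtension
end Bp

/-! ### The strata -/

theorem PointData.nonempty_iso {d r : ℕ} {β : Knum T} {x y : PointData T n p d r β}
    (h : x ≈ y) : Nonempty (x.obj ≅ y.obj) := by
  obtain ⟨f, -, h⟩ := h
  exact ⟨Bp.isoMk f (LinearEquiv.refl ℂ _) fun v => (h v).symm⟩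

end SheafTriples

end

/-! ### Assembly of the five assertions. -/

theorem mainTheorem3 (T : SheafTriples.PolarizedThreefold) (n : ℤ) (p : Polynomial ℚ) (d : ℕ)
    (β : SheafTriples.Knum T) :
    (SheafTriples.StandingCondition T p β →
      ∀ βk ∈ SheafTriples.positiveCone T p, ∀ βl ∈ SheafTriples.positiveCone T p,
        βk + βl = β → (βk, βl) ∈ SheafTriples.decompositions T p β) ∧
    (SheafTriples.stssLocus T n p d β =
        SheafTriples.nonsplitLocus T n p d β ∪ SheafTriples.splitLocus T n p d β ∧
      Disjoint (SheafTriples.nonsplitLocus T n p d β) (SheafTriples.splitLocus T n p d β)) ∧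
    (SheafTriples.nonsplitLocus T n p d β =
        ⋃ γ ∈ SheafTriples.decompositions T p β, SheafTriples.nonsplitStratum T n p d β γ ∧
      (SheafTriples.decompositions T p β).PairwiseDisjoint
        (SheafTriples.nonsplitStratum T n p d β)) ∧
    (∀ γ ∈ SheafTriples.decompositions T p β,
      SheafTriples.nonsplitStratum T n p d β γ =
          SheafTriples.stratumOne T n p d β γ ∪ SheafTriples.stratumTwo T n p d β γ ∧
        Disjoint (SheafTriples.stratumOne T n p d β γ) (SheafTriples.stratumTwo T n p d β γ) ∧
        (γ.1 ≠ γ.2 → SheafTriples.stratumTwo T n p d β γ = ∅)) ∧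
    (∀ (E₂ : SheafTriples.Bp T n p) (e e' : E₂.StableExtension),
      e.type ∈ SheafTriples.decompositions T p β → e'.type ∈ SheafTriples.decompositions T p β →
      ¬ e.IsSplit →
        e'.type = e.type ∧ ¬ e'.IsSplit ∧ Nonempty (e.E₁.F ≅ e'.E₁.F) ∧ Nonempty (e.E₃ ≅ e'.E₃) ∧
          (¬ Limits.IsZero e.E₃.F → ∃ (a : e.E₁ ≅ e'.E₁) (b : e.E₃ ≅ e'.E₃),
            a.hom ≫ e'.ι = e.ι ∧ e.π ≫ b.hom = e'.π)) := by
  open SheafTriples in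
  refine ⟨fun h βk hk βl hl hβ => ⟨hβ, fun F hF hc => .inr (h βk hk βl hl hβ F hF (.inl hc)),
    fun F hF hc => .inr (h βk hk βl hl hβ F hF (.inr hc))⟩, ⟨?_, ?_⟩, ⟨?_, ?_⟩,
    fun γ hγ => ⟨?_, ?_, ?_⟩, fun E₂ e e' he he' hns => e.uniqueness e' he he' hns⟩
  · ext x
    constructor
    · rintro ⟨y, e, hy, he, -⟩
      by_cases h : e.IsSplit
      · exact .inr ⟨y, e, hy, he, h⟩
      · exact .inl ⟨y, e, hy, he, h⟩
    · rintro (⟨y, e, hy, he, -⟩ | ⟨y, e, hy, he, -⟩) <;> exact ⟨y, e, hy, he, trivial⟩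
  · rw [Set.disjoint_left]
    rintro x ⟨y, e, rfl, he, hns⟩ ⟨y', e', hy, he', hs⟩
    -- The two extensions live on different representatives of one point; transporting `e` along `a`
    -- puts both on the same object, where uniqueness applies.
    obtain ⟨a⟩ := PointData.nonempty_iso (Quotient.exact hy.symm)
    exact ((e.transport a).uniqueness e' he he' fun h => hns (e.isSplit_of_transport a h)).2.1 hs
  · ext x
    simp only [Set.mem_iUnion]
    constructor
    · rintro ⟨y, e, hy, he, hns⟩
      exact ⟨e.type, he, y, e, hy, rfl, hns⟩
    · rintro ⟨γ, hγ, y, e, hy, rfl, hns⟩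
      exact ⟨y, e, hy, hγ, hns⟩
  · intro γ hγ γ' hγ' hne
    rw [Function.onFun, Set.disjoint_left]
    rintro x ⟨y, e, rfl, rfl, hns⟩ ⟨y', e', hy, rfl, -⟩
    obtain ⟨a⟩ := PointData.nonempty_iso (Quotient.exact hy.symm)
    exact hne ((e.transport a).uniqueness e' hγ hγ'
      fun h => hns (e.isSplit_of_transport a h)).1.symm
  · ext x
    constructor
    · rintro ⟨y, e, hy, he, hns⟩
      by_cases h : e.EndsIsomorphic
      · exact .inr ⟨y, e, hy, he, hns, h⟩
      · exact .inl ⟨y, e, hy, he, hns, h⟩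
    · rintro (⟨y, e, hy, he, hns, -⟩ | ⟨y, e, hy, he, hns, -⟩) <;> exact ⟨y, e, hy, he, hns⟩
  · rw [Set.disjoint_right]
    rintro x ⟨y, e, rfl, rfl, hns, hiso⟩ ⟨y', e', hy, he', -, hn⟩
    obtain ⟨a⟩ := PointData.nonempty_iso (Quotient.exact hy.symm)
    exact hn ((e.transport a).endsIsomorphic_of_not_isSplit e' hγ
      ((Set.mem_singleton_iff.1 he').symm ▸ hγ) (fun h => hns (e.isSplit_of_transport a h)) hiso)
  · intro hne
    refine Set.eq_empty_of_forall_notMem ?_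
    rintro x ⟨y, e, -, rfl, -, ⟨c⟩⟩
    exact hne (Bp.cls_fst_eq_of_iso c)
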